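/- **Setting.** Consider followers $1,\dots,m$ with states $x_i\in\mathbb R^n$ and leaders $m+1,\dots,N$ with states $x_j\in\mathbb R^n$, on a weighted digraph with weights $a_{ij}\ge 0$, $a_{ii}=0$ (between followers) and $b_{ij}\ge 0$ (from leader $j$ to follower $i$). Put $$P_i(t)=\sum_{j\le m}a_{ij}(x_i(t)-x_j(t))+\sum_{j>m}b_{ij}(x_i(t)-x_j(t)),$$ let $L_{\mathcal F}=\mathrm{diag}\big(\sum_j a_{ij}\big)-(a_{ij})$ be the follower Laplacian and $M=L_{\mathcal F}+\mathrm{diag}\big(\sum_{j>m}b_{ij}\big)$. The leaders obey $\dot x_j=Ax_j$ and the followers $\dot x_i=Ax_i+Bu_i$ with $u_i(t)=-KP_i(t_k^i)$ for $t\in[t_k^i,t_{k+1}^i)$. The trigger instants are $t_0^i=0$ and $t_{k+1}^i=\inf\{t>t_k^i: f_i(t)\ge 0\}$ ($=\infty$ if there is no such $t$), with the static trigger function $$f_i(t)=\int_{t_k^i}^t\|e_i(s)\|^2ds-\int_{t_k^i}^t\big(k_i\|P_i(t_k^i)\|^2+\beta e^{-\sigma s}\big)ds,\qquad e_i(s)=P_i(t_k^i)-P_i(s),$$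 where $k_i\ge 0$ and $\beta,\sigma>0$. Consider any solution on an interval $[0,T)$, $0<T\le\infty$, such that the trigger instants of no agent accumulate inside $[0,T)$ (they are allowed to accumulate at $T$; every solution has this property up to its first accumulation time; trigger instants are those before $T$). For a follower $i$ let $$\Gamma_i(t)=\Big\|-A\hat P_i(t)+BK\Big[\sum_{j\le m}a_{ij}\big(\hat P_i(t)-\hat P_j(t)\big)+\sum_{j>m}b_{ij}\hat P_i(t)\Big]\Big\|,$$ where $\hat P_j(t)$ is $P_j$ at the last trigger instant of follower $j$ up to time $t$. Matrix norms are spectral norms. **Theorem.** 1. There is no Zeno behaviour: for no follower $i$ do the trigger instants $t_k^i$ converge, as $k\to\infty$, to a finite time. 2. For every follower $i$ the function $\Gamma_i$ is bounded by a constant $h_i>0$ on each bounded part of $[0,T)$. One constant $h_i>0$ (which may depend on the solution) bounds $\Gamma_i$ on all of $[0,T)$ provided the design is stabilizing in the following sense: $\Psi=\mathrm{diag}(\psi_1,\dots,\psi_m)>0$ and $\eta>0$ satisfy $\Psi M+M^{T}\Psi>\eta\Psi$; $R=R^T>0$ satisfies $A^TR+RA-\eta RBB^TR<-\eta I$; $K=B^TR$;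 $v>0$ and $\varsigma=\eta\psi_0-v>0$, where $\psi_0\le\psi_i$ for all $i$; $\rho\ge\lambda_{\max}\big(\Psi^2\otimes(RBK)^2\big)$; and $k_i\le k_{\max}$ for all $i$, with $$\sqrt{k_{\max}}<\frac{\sqrt{\varsigma v}}{\sqrt{\rho}\,\|M\|+\sqrt{\varsigma v}}.$$ 3. Let $A\ne0$, let $t_k^i<\infty$ be a trigger instant of follower $i$, and let $h_i>0$ be any constant with $\Gamma_i\le h_i$ on $[t_k^i,t_{k+1}^i)\cap[0,T)$. Then the equation $$\tau_k^i=\frac1{\|A\|}\ln\Big(1+\frac{\|A\|}{h_i}\big(\beta e^{-\sigma(t_k^i+\tau_k^i)}\big)^{1/2}\Big)$$ has exactly one real solution $\tau_k^i$; it is positive, and $t_{k+1}^i-t_k^i\ge\tau_k^i$. Moreover, if $t_{k+1}^i<\infty$, then $$t_{k+1}^i-t_k^i\ \ge\ \frac1{\|A\|}\ln\Big(1+\frac{\|A\|}{h_i}\big(\beta e^{-\sigma t_{k+1}^i}\big)^{1/2}\Big).$$ -/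

import Mathlib

open scoped Kronecker Matrix

noncomputable section

namespace EventTriggered

/-- Weighted directed communication topology on `m` followers and `r` leaders.
`a i j > 0` means that follower `i` receives information from follower `j`, and
`b i l > 0` that follower `i` receives information from leader `l`; there are no self-loops. -/
structure Topology (m r : ℕ) where
  a : Matrix (Fin m) (Fin m) ℝ
  b : Matrix (Fin m) (Fin r) ℝ
  a_nonneg : ∀ i j, 0 ≤ a i j
  a_diag : ∀ i, a i i = 0
  b_nonneg : ∀ i l, 0 ≤ b i l

/-- The follower Laplacian plus the diagonal matrices of leader weights. -/
def Topology.M {m r : ℕ} (G : Topology m r) : Matrix (Fin m) (Fin m) ℝ :=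
  (Matrix.diagonal (fun i => ∑ j, G.a i j) - G.a) +
    ∑ l : Fin r, Matrix.diagonal (fun i => G.b i l)

/-- Spectral norm of a square matrix (operator norm for the Euclidean norm). -/
def specNorm {d : ℕ} (A : Matrix (Fin d) (Fin d) ℝ) : ℝ :=
  ‖Matrix.toEuclideanCLM (𝕜 := ℝ) A‖

/-- Data of a leader-follower network of linear agents with sampled-data feedback gain `K` and
the parameters `κ i`, `β`, `σ` of the static trigger rule. -/
structure Network (m r n p : ℕ) where
  G : Topology m r
  A : Matrix (Fin n) (Fin n) ℝ
  B : Matrix (Fin n) (Fin p) ℝ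
  K : Matrix (Fin p) (Fin n) ℝ
  κ : Fin m → ℝ
  β : ℝ
  σ : ℝ

/-- A follower/leader trajectory together with the trigger instants of the followers.
The instant `τ i k` is `⊤` when agent `i` has no `k`-th trigger. -/
structure Trajectory (m r n : ℕ) where
  /-- follower states -/
  x : Fin m → ℝ → EuclideanSpace ℝ (Fin n)
  /-- leader states -/
  z : Fin r → ℝ → EuclideanSpace ℝ (Fin n)
  /-- trigger instants -/
  τ : Fin m → ℕ → EReal

variable {m r n p : ℕ}

/-- The relative state `P_i(t) = ∑ a_ij (x_i - x_j) + ∑ b_il (x_i - z_l)`. -/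
def relState (N : Network m r n p) (X : Trajectory m r n) (i : Fin m) (t : ℝ) :
    EuclideanSpace ℝ (Fin n) :=
  ∑ j, N.G.a i j • (X.x i t - X.x j t) + ∑ l, N.G.b i l • (X.x i t - X.z l t)

/-- The last trigger instant of agent `i` up to and including time `t`. -/
def lastTrigger (X : Trajectory m r n) (i : Fin m) (t : ℝ) : ℝ :=
  sSup {s : ℝ | s ≤ t ∧ ∃ k, X.τ i k = (s : EReal)}

/-- The value of `P_i` sampled at the last trigger instant of agent `i`. -/
def heldState (N : Network m r n p) (X : Trajectory m r n) (i : Fin m) (t : ℝ) :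
    EuclideanSpace ℝ (Fin n) :=
  relState N X i (lastTrigger X i t)

/-- The control input of follower `i`: `u_i(t) = - K P_i(t_k^i)` for `t ∈ [t_k^i, t_{k+1}^i)`. -/
def control (N : Network m r n p) (X : Trajectory m r n) (i : Fin m) (t : ℝ) :
    EuclideanSpace ℝ (Fin p) :=
  - Matrix.toEuclideanLin N.K (heldState N X i t)

/-- The static trigger function `f_i(t)` of agent `i` whose last trigger instant is `s`, with
`e_i(v) = P_i(s) - P_i(v)`. -/
def triggerFun (N : Network m r n p) (X : Trajectory m r n) (i : Fin m) (s t : ℝ) : ℝ :=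
  (∫ v in s..t, ‖relState N X i s - relState N X i v‖ ^ 2) -
    ∫ v in s..t, (N.κ i * ‖relState N X i s‖ ^ 2 + N.β * Real.exp (-N.σ * v))

/-- `X` is an execution of the event-triggered closed loop on the time interval `[0, T)`, `T ≤ ∞`.

The trajectory is continuous and solves the closed-loop equations; the derivative is taken from the
right, since the inputs jump at the trigger instants. Every time of `[0, T)` lies between two
consecutive trigger instants of each follower (so that the input is defined there), but the instants
may accumulate at `T`. An evolution whose trigger instants accumulate somewhere is, up to its first
accumulation point `T`, an execution on `[0, T)`. Triggers at or after `T` are not part of it. -/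
structure IsExecution (N : Network m r n p) (T : EReal) (X : Trajectory m r n) : Prop where
  follower_cont : ∀ i, ContinuousOn (X.x i) {t : ℝ | 0 ≤ t ∧ (t : EReal) < T}
  leader_cont : ∀ l, ContinuousOn (X.z l) {t : ℝ | 0 ≤ t ∧ (t : EReal) < T}
  leader_dyn : ∀ l (t : ℝ), 0 ≤ t → (t : EReal) < T →
    HasDerivWithinAt (X.z l) (Matrix.toEuclideanLin N.A (X.z l t)) (Set.Ici t) t
  follower_dyn : ∀ i (t : ℝ), 0 ≤ t → (t : EReal) < T →
    HasDerivWithinAt (X.x i)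
      (Matrix.toEuclideanLin N.A (X.x i t) + Matrix.toEuclideanLin N.B (control N X i t))
      (Set.Ici t) t
  trigger_zero : ∀ i, X.τ i 0 = 0
  trigger_succ : ∀ i k, X.τ i (k + 1) =
    sInf ((fun t : ℝ => (t : EReal)) ''
      {t : ℝ | X.τ i k < (t : EReal) ∧ (t : EReal) < T ∧
        0 ≤ triggerFun N X i (X.τ i k).toReal t})
  cover : ∀ i (t : ℝ), 0 ≤ t → (t : EReal) < T →
    ∃ k, X.τ i k ≤ (t : EReal) ∧ (t : EReal) < X.τ i (k + 1)

/-- Zeno behaviour of agent `i`: its trigger instants converge to a finite time. -/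
def Zeno (X : Trajectory m r n) (i : Fin m) : Prop :=
  ∃ tstar : ℝ, Filter.Tendsto (X.τ i) Filter.atTop (nhds (tstar : EReal))

/-- The size `Γ_i(t)` of the forcing term in the equation `e_i' = A e_i + forcing`. A leader has
zero input, hence contributes no sampled value. -/
def forcing (N : Network m r n p) (X : Trajectory m r n) (i : Fin m) (t : ℝ) : ℝ :=
  ‖- Matrix.toEuclideanLin N.A (heldState N X i t) +
    Matrix.toEuclideanLin (N.B * N.K)
      (∑ j, N.G.a i j • (heldState N X i t - heldState N X j t) +
        ∑ l, N.G.b i l • heldState N X i t)‖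

/-- `(1/‖A‖) ln (1 + (‖A‖/h) (β e^{-σ t})^{1/2})`. -/
def gap (N : Network m r n p) (h t : ℝ) : ℝ :=
  1 / specNorm N.A *
    Real.log (1 + specNorm N.A / h * Real.sqrt (N.β * Real.exp (-N.σ * t)))

/-- Stabilizing design of the feedback gain and of the trigger gains: `Ψ = diag ψ` is positive with
`Ψ M + Mᵀ Ψ > η Ψ`, the matrix `R > 0` solves the Riccati inequality
`Aᵀ R + R A - η R B Bᵀ R < - η I`, the feedback is `K = Bᵀ R`, and the gains `κ i` are small:
`κ i ≤ κmax` with `√κmax < √(ς v) / (√ρ ‖M‖ + √(ς v))`, where `ς = η ψ₀ - v > 0`, `ψ₀` is a lower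
bound for the eigenvalues of `Ψ` and `ρ` an upper bound for those of `Ψ² ⊗ (R B K)²`. -/
structure StabilizingDesign (N : Network m r n p) (R : Matrix (Fin n) (Fin n) ℝ) (ψ : Fin m → ℝ)
    (η ψ₀ v ρ κmax : ℝ) : Prop where
  ψ_pos : ∀ i, 0 < ψ i
  η_pos : 0 < η
  M_ineq : (Matrix.diagonal ψ * N.G.M + N.G.Mᵀ * Matrix.diagonal ψ
    - η • Matrix.diagonal ψ).PosDef
  R_pos : R.PosDef
  riccati : (-(N.Aᵀ * R + R * N.A - η • (R * N.B * N.Bᵀ * R)) - η • 1).PosDef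
  gain : N.K = N.Bᵀ * R
  ψ₀_le : ∀ i, ψ₀ ≤ ψ i
  v_pos : 0 < v
  ς_pos : 0 < η * ψ₀ - v
  ρ_bound : (ρ • 1 - ((Matrix.diagonal ψ) ^ 2) ⊗ₖ ((R * N.B * N.K) ^ 2)).PosSemidef
  κ_le : ∀ i, N.κ i ≤ κmax
  κmax_lt : Real.sqrt κmax < Real.sqrt ((η * ψ₀ - v) * v) /
    (Real.sqrt ρ * specNorm N.G.M + Real.sqrt ((η * ψ₀ - v) * v))

end EventTriggered

end

/-!
The relative states `P_i` form a closed system: the right derivative of `P_i` is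
`A P_i - B K ∑ j, M_ij P̂_j`, where `P̂_j` is the value of `P_j` at the last trigger instant of
agent `j` (`IsExecution.relState_hasDeriv`). Everything is deduced from this equation, used with
right derivatives, and from the trigger rule.

*Bounded horizons.* The sampled values are past values of `P`, so the derivative of `P` at time `t`
is at most a constant times `sup_{[0,t]} ‖P‖`. Gronwall's inequality with memory
(`norm_lt_exp_of_deriv_le_past`) bounds `P`, hence `Γ`, on bounded intervals, even if triggers
accumulate at the end `T` of the interval of existence.

*Inter-event times.* At the next trigger instant `t'` after `s` the trigger function is nonnegative,
so the error `e_i` has reached `‖e_i‖² ≥ β e^{-σ t'}` before `t'` (`IsExecution.exists_error_ge`).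
On the other hand `e_i' = A e_i + forcing` and `e_i(s) = 0`, so Gronwall's inequality gives
`‖e_i(t)‖ ≤ (h / ‖A‖) (e^{‖A‖ (t - s)} - 1)` (`IsExecution.norm_error_le`). Comparing the two is the
gap estimate `IsExecution.gap_le`. Zeno behaviour is excluded in the same way, with the cruder
bound `‖e_i(t)‖ ≤ D (t - s)` on a bounded horizon, which does not need `A ≠ 0`
(`IsExecution.not_zeno`).

*Uniform bound.* With `V = ∑ ψ i * ⟪P_i, R P_i⟫`, the design inequalities give
`V' ≤ -ς ∑ ‖P_i‖² + (ρ ‖M‖² / v) ∑ ‖e_i‖²` (`StabilizingDesign.dissipation`), and the smallness of the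
trigger gains turns the right-hand side into a bound `c ∑ (‖e_i‖² - κ i ‖P̂_i‖²)` with `c ≥ 0`
(`StabilizingDesign.exists_supply_rate`). The trigger rule says exactly that the integral of
`‖e_i‖² - κ i ‖P̂_i‖² - β e^{-σ t}` over each inter-event interval is nonpositive; summing over the
intervals, `V` exceeds its initial value by at most `c m β / σ`.
-/

namespace EventTriggered

variable {m r n p : ℕ}

/-! ### Matrices acting on Euclidean vectors -/

lemma specNorm_nonneg {d : ℕ} (A : Matrix (Fin d) (Fin d) ℝ) : 0 ≤ specNorm A := norm_nonneg _

lemma norm_toEuclideanLin_le {d : ℕ} (A : Matrix (Fin d) (Fin d) ℝ)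
    (x : EuclideanSpace ℝ (Fin d)) : ‖Matrix.toEuclideanLin A x‖ ≤ specNorm A * ‖x‖ :=
  (Matrix.toEuclideanCLM (𝕜 := ℝ) A).le_opNorm x

lemma specNorm_pos {d : ℕ} {A : Matrix (Fin d) (Fin d) ℝ} (hA : A ≠ 0) : 0 < specNorm A := by
  refine norm_pos_iff.2 fun h => hA ?_
  simpa using h

lemma toEuclideanLin_mul_apply {a b c : ℕ} (A : Matrix (Fin a) (Fin b) ℝ)
    (B : Matrix (Fin b) (Fin c) ℝ) (x : EuclideanSpace ℝ (Fin c)) :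
    Matrix.toEuclideanLin (A * B) x = Matrix.toEuclideanLin A (Matrix.toEuclideanLin B x) := by
  simp [Matrix.toLpLin_apply, Matrix.mulVec_mulVec]

/-- The coupling term of the followers is the action of `M` on the stacked vector. -/
lemma sum_coupling_eq (G : Topology m r) {E : Type*} [AddCommGroup E] [Module ℝ E]
    (y : Fin m → E) (i : Fin m) :
    ∑ j, G.a i j • (y i - y j) + ∑ l, G.b i l • y i = ∑ j, G.M i j • y j := by
  have h : ∀ j, G.M i j =
      (if i = j then (∑ j, G.a i j) + ∑ l, G.b i l else 0) - G.a i j := by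
    intro j
    rw [Topology.M, Matrix.add_apply, Matrix.sub_apply, Matrix.sum_apply]
    by_cases hij : i = j
    · subst hij
      simp
      ring
    · simp [hij]
  simp only [h, sub_smul, ite_smul, zero_smul, Finset.sum_sub_distrib, Finset.sum_ite_eq,
    Finset.mem_univ, if_true, add_smul, smul_sub, Finset.sum_smul]
  abel

/-! ### Trigger instants of an execution -/

section Execution

variable {N : Network m r n p} {T : EReal} {X : Trajectory m r n}

lemma IsExecution.trigger_le_succ (hX : IsExecution N T X) (i : Fin m) (k : ℕ) :
    X.τ i k ≤ X.τ i (k + 1) := by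
  rw [hX.trigger_succ]
  refine le_sInf ?_
  rintro _ ⟨t, ht, rfl⟩
  exact ht.1.le

lemma IsExecution.trigger_mono (hX : IsExecution N T X) (i : Fin m) : Monotone (X.τ i) :=
  monotone_nat_of_le_succ (hX.trigger_le_succ i)

lemma IsExecution.trigger_nonneg (hX : IsExecution N T X) (i : Fin m) (k : ℕ) :
    0 ≤ X.τ i k := by
  rw [← hX.trigger_zero i]; exact hX.trigger_mono i (Nat.zero_le k)

lemma IsExecution.nonneg_of_trigger (hX : IsExecution N T X) {i : Fin m} {k : ℕ} {s : ℝ}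
    (hs : X.τ i k = s) : 0 ≤ s := by
  have := hX.trigger_nonneg i k
  rw [hs] at this
  exact_mod_cast this

lemma IsExecution.trigger_lt (hX : IsExecution N T X) (hT : 0 < T) {i : Fin m} {k : ℕ} {s : ℝ}
    (hs : X.τ i k = s) : (s : EReal) < T := by
  cases k with
  | zero => rw [← hs, hX.trigger_zero]; exact hT
  | succ k =>
    rw [hX.trigger_succ] at hs
    obtain ⟨_, ⟨t, ht, rfl⟩, -⟩ := sInf_lt_iff.1 (hs.trans_lt (EReal.coe_lt_top s))
    rw [← hs]
    exact (sInf_le (Set.mem_image_of_mem _ ht)).trans_lt ht.2.1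

lemma IsExecution.lastTrigger_eq (hX : IsExecution N T X) {i : Fin m} {k : ℕ} {s t : ℝ}
    (hs : X.τ i k = s) (hst : s ≤ t) (ht : (t : EReal) < X.τ i (k + 1)) :
    lastTrigger X i t = s := by
  refine IsGreatest.csSup_eq ⟨⟨hst, k, hs⟩, ?_⟩
  rintro u ⟨hut, l, hl⟩
  have hlk : l ≤ k := by
    by_contra hlk
    have h1 := hX.trigger_mono i (not_le.1 hlk : k + 1 ≤ l)
    rw [hl] at h1
    exact absurd (ht.trans_le h1) (not_lt.2 (by exact_mod_cast hut))
  have := hX.trigger_mono i hlk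
  rw [hl, hs] at this
  exact_mod_cast this

lemma IsExecution.exists_trigger (hX : IsExecution N T X) (i : Fin m) {t : ℝ} (h0 : 0 ≤ t)
    (ht : (t : EReal) < T) :
    ∃ k, ∃ s : ℝ, X.τ i k = s ∧ 0 ≤ s ∧ s ≤ t ∧ (t : EReal) < X.τ i (k + 1) := by
  obtain ⟨k, hk, hk'⟩ := hX.cover i t h0 ht
  have h := hX.trigger_nonneg i k
  have hr : X.τ i k = ((X.τ i k).toReal : EReal) :=
    (EReal.coe_toReal (ne_top_of_le_ne_top (EReal.coe_ne_top t) hk)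
      (ne_bot_of_le_ne_bot EReal.zero_ne_bot h)).symm
  refine ⟨k, (X.τ i k).toReal, hr, hX.nonneg_of_trigger hr, ?_, hk'⟩
  rw [hr] at hk
  exact_mod_cast hk

lemma IsExecution.lastTrigger_mem (hX : IsExecution N T X) (i : Fin m) {t : ℝ} (h0 : 0 ≤ t)
    (ht : (t : EReal) < T) : lastTrigger X i t ∈ Set.Icc 0 t := by
  obtain ⟨k, s, hs, hs0, hst, hk⟩ := hX.exists_trigger i h0 ht
  rw [hX.lastTrigger_eq hs hst hk]
  exact ⟨hs0, hst⟩

/-! ### Dynamics of the relative states -/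

lemma IsExecution.relState_continuousOn (hX : IsExecution N T X) (i : Fin m) :
    ContinuousOn (relState N X i) {t : ℝ | 0 ≤ t ∧ (t : EReal) < T} := by
  unfold relState
  refine ContinuousOn.add ?_ ?_ <;> refine continuousOn_finsetSum _ fun j _ => ?_
  · exact ((hX.follower_cont i).sub (hX.follower_cont j)).const_smul (N.G.a i j)
  · exact ((hX.follower_cont i).sub (hX.leader_cont j)).const_smul (N.G.b i j)

lemma IsExecution.relState_continuousOn_Icc (hX : IsExecution N T X) (i : Fin m) {s t : ℝ}
    (hs : 0 ≤ s) (ht : (t : EReal) < T) : ContinuousOn (relState N X i) (Set.Icc s t) :=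
  (hX.relState_continuousOn i).mono fun _ hu =>
    ⟨hs.trans hu.1, (EReal.coe_le_coe_iff.2 hu.2).trans_lt ht⟩

/-- The right derivative of `P_i`. The relative states form a closed system: the
derivative depends on the current value and on the sampled values of `P` only. -/
noncomputable def relDeriv (N : Network m r n p) (X : Trajectory m r n) (i : Fin m) (t : ℝ) :
    EuclideanSpace ℝ (Fin n) :=
  Matrix.toEuclideanLin N.A (relState N X i t) -
    Matrix.toEuclideanLin (N.B * N.K) (∑ j, N.G.M i j • heldState N X j t)

lemma IsExecution.relState_hasDeriv (hX : IsExecution N T X) (i : Fin m) {t : ℝ} (h0 : 0 ≤ t)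
    (ht : (t : EReal) < T) :
    HasDerivWithinAt (relState N X i) (relDeriv N X i t) (Set.Ici t) t := by
  have h := (HasDerivWithinAt.fun_sum (u := Finset.univ) fun j _ =>
    ((hX.follower_dyn i t h0 ht).sub (hX.follower_dyn j t h0 ht)).const_smul (N.G.a i j)).add
    (HasDerivWithinAt.fun_sum (u := Finset.univ) fun l _ =>
    ((hX.follower_dyn i t h0 ht).sub (hX.leader_dyn l t h0 ht)).const_smul (N.G.b i l))
  refine HasDerivWithinAt.congr_deriv (f := relState N X i) h ?_
  rw [relDeriv, ← sum_coupling_eq]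
  simp only [relState, control, toEuclideanLin_mul_apply, map_add, map_sum, map_smul, map_sub,
    map_neg, smul_sub, smul_add, smul_neg, Finset.sum_add_distrib, Finset.sum_sub_distrib,
    Finset.sum_neg_distrib]
  abel

lemma forcing_eq (N : Network m r n p) (X : Trajectory m r n) (i : Fin m) (t : ℝ) :
    forcing N X i t = ‖- Matrix.toEuclideanLin N.A (heldState N X i t) +
      Matrix.toEuclideanLin (N.B * N.K) (∑ j, N.G.M i j • heldState N X j t)‖ := by
  rw [forcing, sum_coupling_eq N.G (fun j => heldState N X j t) i]

/-- A bound `y` on the current and the sampled relative states bounds the right derivatives and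
the forcing terms by `growthRate N * y`. -/
noncomputable def growthRate (N : Network m r n p) : ℝ :=
  specNorm N.A + specNorm (N.B * N.K) * ∑ i, ∑ j, |N.G.M i j|

lemma growthRate_nonneg (N : Network m r n p) : 0 ≤ growthRate N :=
  add_nonneg (specNorm_nonneg _) (mul_nonneg (specNorm_nonneg _)
    (Finset.sum_nonneg fun _ _ => Finset.sum_nonneg fun _ _ => abs_nonneg _))

lemma norm_add_coupling_le (N : Network m r n p) {y : ℝ} (i : Fin m)
    {x : EuclideanSpace ℝ (Fin n)} {w : Fin m → EuclideanSpace ℝ (Fin n)} (hx : ‖x‖ ≤ y)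
    (hw : ∀ j, ‖w j‖ ≤ y) :
    ‖Matrix.toEuclideanLin N.A x‖ + ‖Matrix.toEuclideanLin (N.B * N.K) (∑ j, N.G.M i j • w j)‖
      ≤ growthRate N * y := by
  have hy : 0 ≤ y := (norm_nonneg _).trans hx
  have h1 : ‖∑ j, N.G.M i j • w j‖ ≤ (∑ i, ∑ j, |N.G.M i j|) * y := by
    calc ‖∑ j, N.G.M i j • w j‖ ≤ ∑ j, |N.G.M i j| * y := by
          refine norm_sum_le_of_le _ fun j _ => ?_
          rw [norm_smul, Real.norm_eq_abs]
          exact mul_le_mul_of_nonneg_left (hw j) (abs_nonneg _)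
      _ = (∑ j, |N.G.M i j|) * y := by rw [Finset.sum_mul]
      _ ≤ _ := mul_le_mul_of_nonneg_right (Finset.single_le_sum
          (f := fun i => ∑ j, |N.G.M i j|)
          (fun _ _ => Finset.sum_nonneg fun _ _ => abs_nonneg _) (Finset.mem_univ i)) hy
  have h2 := (norm_toEuclideanLin_le N.A x).trans
    (mul_le_mul_of_nonneg_left hx (specNorm_nonneg _))
  have h3 := (norm_toEuclideanLin_le (N.B * N.K) (∑ j, N.G.M i j • w j)).trans
    (mul_le_mul_of_nonneg_left h1 (specNorm_nonneg _))
  rw [growthRate, add_mul, mul_assoc]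
  exact add_le_add h2 h3

lemma IsExecution.norm_relDeriv_le (hX : IsExecution N T X) (i : Fin m) {t y : ℝ} (h0 : 0 ≤ t)
    (ht : (t : EReal) < T) (hy : ∀ j, ∀ u ∈ Set.Icc 0 t, ‖relState N X j u‖ ≤ y) :
    ‖relDeriv N X i t‖ ≤ growthRate N * y :=
  (norm_sub_le _ _).trans (norm_add_coupling_le N i (hy i t ⟨h0, le_rfl⟩)
    fun j => hy j _ (hX.lastTrigger_mem j h0 ht))

lemma IsExecution.forcing_le (hX : IsExecution N T X) (i : Fin m) {t y : ℝ} (h0 : 0 ≤ t)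
    (ht : (t : EReal) < T) (hy : ∀ j, ∀ u ∈ Set.Icc 0 t, ‖relState N X j u‖ ≤ y) :
    forcing N X i t ≤ growthRate N * y := by
  rw [forcing_eq]
  refine (norm_add_le _ _).trans ?_
  rw [norm_neg]
  exact norm_add_coupling_le N i (hy i _ (hX.lastTrigger_mem i h0 ht))
    fun j => hy j _ (hX.lastTrigger_mem j h0 ht)

end Execution

/-! ### Growth of systems driven by their past -/

/-- Gronwall's inequality with memory: if the right derivatives at time `t` are at most `C` times
any bound valid on `[0, t]`, the solution grows at most like `exp (C t)`. -/
lemma norm_lt_exp_of_deriv_le_past {ι E : Type*} [Finite ι] [NormedAddCommGroup E]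
    [NormedSpace ℝ E] {f f' : ι → ℝ → E} {S C c : ℝ} (hC : 0 ≤ C)
    (hc : ∀ i, ‖f i 0‖ < c) (hf : ∀ i, ContinuousOn (f i) (Set.Icc 0 S))
    (hf' : ∀ i, ∀ t ∈ Set.Ico 0 S, HasDerivWithinAt (f i) (f' i t) (Set.Ici t) t)
    (bound : ∀ i, ∀ t ∈ Set.Ico 0 S, ∀ y, (∀ j, ∀ u ∈ Set.Icc 0 t, ‖f j u‖ ≤ y) →
      ‖f' i t‖ ≤ C * y) (i : ι) :
    ∀ t ∈ Set.Icc 0 S, ‖f i t‖ < c * Real.exp (C * t) := by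
  by_contra! hcon
  -- the first time at which the claimed bound fails for some index
  set F : Set ℝ := ⋃ j, {t ∈ Set.Icc 0 S | 0 ≤ ‖f j t‖ - c * Real.exp (C * t)} with hF
  have hFc : IsCompact F := by
    refine isCompact_iUnion fun j => ?_
    have : ContinuousOn (fun t => ‖f j t‖ - c * Real.exp (C * t)) (Set.Icc 0 S) :=
      (hf j).norm.sub (by fun_prop)
    exact isCompact_Icc.of_isClosed_subset
      (this.preimage_isClosed_of_isClosed isClosed_Icc isClosed_Ici) fun _ h => h.1
  obtain ⟨t₀, ht₀, h₀⟩ := hcon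
  have hne : F.Nonempty := ⟨t₀, Set.mem_iUnion.2 ⟨i, ht₀, sub_nonneg.2 h₀⟩⟩
  obtain ⟨t₁, ht₁, hmin⟩ := hFc.exists_isLeast hne
  obtain ⟨j, htS, hj⟩ := Set.mem_iUnion.1 ht₁
  have hlt : ∀ l, ∀ u ∈ Set.Ico 0 t₁, ‖f l u‖ < c * Real.exp (C * u) := by
    intro l u hu
    by_contra! h
    exact absurd (hmin (Set.mem_iUnion.2 ⟨l, ⟨hu.1, hu.2.le.trans htS.2⟩, sub_nonneg.2 h⟩))
      (not_le.2 hu.2)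
  have hc0 : 0 ≤ c := (norm_nonneg _).trans (hc i).le
  have key := image_norm_le_of_norm_deriv_right_le_deriv_boundary (a := 0) (b := t₁)
    (f := f j) (f' := f' j)
    (B := fun t => ‖f j 0‖ + c * (Real.exp (C * t) - 1))
    (B' := fun t => C * (c * Real.exp (C * t)))
    ((hf j).mono (Set.Icc_subset_Icc_right htS.2))
    (fun t ht => hf' j t ⟨ht.1, ht.2.trans_le htS.2⟩) (by simp)
    (fun t => by
      have := ((((hasDerivAt_id t).const_mul C).exp.sub_const 1).const_mul c).const_add ‖f j 0‖
      refine this.congr_deriv ?_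
      simp; ring)
    (fun t ht => bound j t ⟨ht.1, ht.2.trans_le htS.2⟩ _ fun l u hu =>
      (hlt l u ⟨hu.1, hu.2.trans_lt ht.2⟩).le.trans (by gcongr; exact hu.2))
    (Set.right_mem_Icc.2 htS.1)
  have := hc j
  have := sub_nonneg.1 hj
  linarith

lemma IsExecution.exists_relState_bound {N : Network m r n p} {T : EReal} {X : Trajectory m r n}
    (hX : IsExecution N T X) (S : ℝ) :
    ∃ y, 0 < y ∧ ∀ i, ∀ t : ℝ, 0 ≤ t → t ≤ S → (t : EReal) < T → ‖relState N X i t‖ ≤ y := by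
  set c : ℝ := ∑ i, ‖relState N X i 0‖ + 1
  have hc : ∀ i, ‖relState N X i 0‖ < c := fun i => by
    have := Finset.single_le_sum (f := fun i => ‖relState N X i 0‖)
      (fun _ _ => norm_nonneg _) (Finset.mem_univ i)
    linarith
  have hc0 : 0 < c := by positivity
  refine ⟨c * Real.exp (growthRate N * S), by positivity, fun i t h0 htS htT => ?_⟩
  have hT : ∀ u ∈ Set.Ico 0 t, (u : EReal) < T := fun u hu =>
    (EReal.coe_lt_coe_iff.2 hu.2).trans htT
  refine (norm_lt_exp_of_deriv_le_past (S := t) (growthRate_nonneg N) hc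
    (fun j => hX.relState_continuousOn_Icc j le_rfl htT)
    (fun j u hu => hX.relState_hasDeriv j hu.1 (hT u hu))
    (fun j u hu y hy => hX.norm_relDeriv_le j hu.1 (hT u hu) hy) i t ⟨h0, le_rfl⟩).le.trans ?_
  have := growthRate_nonneg N
  gcongr

lemma IsExecution.exists_forcing_bound {N : Network m r n p} {T : EReal} {X : Trajectory m r n}
    (hX : IsExecution N T X) (S : ℝ) :
    ∃ h : ℝ, 0 < h ∧ ∀ i, ∀ t : ℝ, 0 ≤ t → t ≤ S → (t : EReal) < T → forcing N X i t ≤ h := by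
  obtain ⟨y, hy, hb⟩ := hX.exists_relState_bound S
  have hg := growthRate_nonneg N
  refine ⟨growthRate N * y + 1, by positivity, fun i t h0 htS htT => ?_⟩
  have := hX.forcing_le i h0 htT fun j u hu =>
    hb j u hu.1 (hu.2.trans htS) ((EReal.coe_le_coe_iff.2 hu.2).trans_lt htT)
  linarith

variable {N : Network m r n p} {T : EReal} {X : Trajectory m r n}

/-! ### The trigger function between two trigger instants -/

/-- The integrand of the trigger function of agent `i` with last trigger instant `s`. -/
noncomputable def triggerRate (N : Network m r n p) (X : Trajectory m r n) (i : Fin m)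
    (s v : ℝ) : ℝ :=
  ‖relState N X i s - relState N X i v‖ ^ 2 -
    (N.κ i * ‖relState N X i s‖ ^ 2 + N.β * Real.exp (-N.σ * v))

lemma IsExecution.triggerRate_continuousOn (hX : IsExecution N T X) (i : Fin m) {s t : ℝ}
    (hs : 0 ≤ s) (ht : (t : EReal) < T) :
    ContinuousOn (triggerRate N X i s) (Set.Icc s t) := by
  have h := hX.relState_continuousOn_Icc i hs ht
  unfold triggerRate
  fun_prop

lemma IsExecution.triggerFun_eq (hX : IsExecution N T X) (i : Fin m) {s t : ℝ}
    (hs : 0 ≤ s) (hst : s ≤ t) (ht : (t : EReal) < T) :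
    triggerFun N X i s t = ∫ v in s..t, triggerRate N X i s v := by
  have h := hX.relState_continuousOn_Icc i hs ht
  unfold triggerRate triggerFun
  rw [intervalIntegral.integral_sub]
  · exact ContinuousOn.intervalIntegrable_of_Icc hst (by fun_prop)
  · exact Continuous.intervalIntegrable (by fun_prop) _ _

lemma IsExecution.triggerFun_continuousOn (hX : IsExecution N T X) (i : Fin m) {s t : ℝ}
    (hs : 0 ≤ s) (hst : s ≤ t) (ht : (t : EReal) < T) :
    ContinuousOn (triggerFun N X i s) (Set.Icc s t) := by
  have h : ContinuousOn (fun u => ∫ v in s..u, triggerRate N X i s v) (Set.Icc s t) := by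
    have := hX.triggerRate_continuousOn i hs ht
    rw [← Set.uIcc_of_le hst] at this ⊢
    exact intervalIntegral.continuousOn_primitive_interval
      (this.integrableOn_compact isCompact_uIcc)
  exact h.congr fun u hu => hX.triggerFun_eq i hs hu.1
    ((EReal.coe_le_coe_iff.2 hu.2).trans_lt ht)

/-- A nonnegative trigger function forces a large sampling error at some earlier time. -/
lemma IsExecution.exists_error_ge (hX : IsExecution N T X) (i : Fin m) (hκ : 0 ≤ N.κ i)
    {s t : ℝ} (hs : 0 ≤ s) (hst : s < t) (ht : (t : EReal) < T)
    (hf : 0 ≤ triggerFun N X i s t) :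
    ∃ v ∈ Set.Ioo s t,
      N.β * Real.exp (-N.σ * v) ≤ ‖relState N X i s - relState N X i v‖ ^ 2 := by
  by_contra! hcon
  have := intervalIntegral.intervalIntegral_pos_of_pos_on
    (f := fun v => - triggerRate N X i s v)
    ((hX.triggerRate_continuousOn i hs ht).neg.intervalIntegrable_of_Icc hst.le)
    (fun v hv => by
      have h1 := hcon v hv
      have h2 : 0 ≤ N.κ i * ‖relState N X i s‖ ^ 2 := by positivity
      rw [triggerRate]; linarith) hst
  rw [intervalIntegral.integral_neg, ← hX.triggerFun_eq i hs hst.le ht] at this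
  linarith

lemma IsExecution.trigger_lt_succ (hX : IsExecution N T X) (hT : 0 < T) (hβ : 0 < N.β)
    {i : Fin m} (hκ : 0 ≤ N.κ i) {k : ℕ} {s : ℝ} (hs : X.τ i k = s) :
    (s : EReal) < X.τ i (k + 1) := by
  have hs0 := hX.nonneg_of_trigger hs
  have hsT := hX.trigger_lt hT hs
  have hc : ContinuousWithinAt
      (fun v => N.β * Real.exp (-N.σ * v) - ‖relState N X i s - relState N X i v‖ ^ 2)
      {t : ℝ | 0 ≤ t ∧ (t : EReal) < T} s := by
    have := (hX.relState_continuousOn i) s ⟨hs0, hsT⟩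
    fun_prop
  have hpos : ∀ᶠ v in nhdsWithin s {t : ℝ | 0 ≤ t ∧ (t : EReal) < T},
      0 < N.β * Real.exp (-N.σ * v) - ‖relState N X i s - relState N X i v‖ ^ 2 := by
    refine hc.eventually (lt_mem_nhds ?_)
    simp
    positivity
  obtain ⟨ε, hε, hball⟩ := Metric.mem_nhdsWithin_iff.1 hpos
  have hle : ((s + ε : ℝ) : EReal) ≤ X.τ i (k + 1) := by
    rw [hX.trigger_succ]
    refine le_sInf ?_
    rintro _ ⟨t, ⟨hst, htT, hf⟩, rfl⟩
    rw [hs] at hst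
    rw [hs, EReal.toReal_coe] at hf
    have hst' : s < t := EReal.coe_lt_coe_iff.1 hst
    refine EReal.coe_le_coe_iff.2 ?_
    by_contra! hlt
    obtain ⟨v, hv, hev⟩ := hX.exists_error_ge i hκ hs0 hst' htT hf
    have := hball ⟨by
      rw [Metric.mem_ball, Real.dist_eq, abs_of_pos (sub_pos.2 hv.1)]
      linarith [hv.2], hs0.trans hv.1.le, (EReal.coe_lt_coe_iff.2 hv.2).trans htT⟩
    simp only [Set.mem_ofPred_eq] at this
    linarith
  exact (EReal.coe_lt_coe_iff.2 (by linarith)).trans_le hle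

/-- At a trigger instant the trigger function is nonnegative, since it is continuous. -/
lemma IsExecution.triggerFun_succ_nonneg (hX : IsExecution N T X) {i : Fin m} {k : ℕ} {s s' : ℝ}
    (hs : X.τ i k = s) (hs' : X.τ i (k + 1) = s') : 0 ≤ triggerFun N X i s s' := by
  have hs0 := hX.nonneg_of_trigger hs
  have hss' : s ≤ s' := by
    have := hX.trigger_le_succ i k
    rw [hs, hs'] at this
    exact_mod_cast this
  have hinf := hX.trigger_succ i k
  rw [hs', hs, EReal.toReal_coe] at hinf
  set W := {t : ℝ | (s : EReal) < t ∧ (t : EReal) < T ∧ 0 ≤ triggerFun N X i s t}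
  obtain ⟨_, ⟨t₀, ht₀, rfl⟩, -⟩ := sInf_lt_iff.1 (hinf.symm.trans_lt (EReal.coe_lt_top s'))
  have hle : ∀ t ∈ W, s' ≤ t := fun t ht => by
    have := sInf_le (Set.mem_image_of_mem (fun t : ℝ => (t : EReal)) ht)
    rw [← hinf] at this
    exact_mod_cast this
  by_contra! hneg
  have hst₀ : s ≤ t₀ := hss'.trans (hle t₀ ht₀)
  have hev : ∀ᶠ t in nhdsWithin s' (Set.Icc s t₀), triggerFun N X i s t < 0 :=
    (hX.triggerFun_continuousOn i hs0 hst₀ ht₀.2.1 s' ⟨hss', hle t₀ ht₀⟩).eventually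
      (gt_mem_nhds hneg)
  obtain ⟨ε, hε, hball⟩ := Metric.mem_nhdsWithin_iff.1 hev
  have hlt : sInf ((fun t : ℝ => (t : EReal)) '' W) < ((s' + ε : ℝ) : EReal) := by
    rw [← hinf]
    exact EReal.coe_lt_coe_iff.2 (by linarith)
  obtain ⟨_, ⟨t₁, ht₁, rfl⟩, ht₁ε⟩ := sInf_lt_iff.1 hlt
  have ht₁ε : t₁ < s' + ε := EReal.coe_lt_coe_iff.1 ht₁ε
  have hmin : min t₁ t₀ ∈ W := by
    rcases min_choice t₁ t₀ with h | h <;> rw [h] <;> assumption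
  have hmem : min t₁ t₀ ∈ Metric.ball s' ε ∩ Set.Icc s t₀ := by
    refine ⟨?_, hss'.trans (hle _ hmin), min_le_right _ _⟩
    rw [Metric.mem_ball, Real.dist_eq, abs_of_nonneg (sub_nonneg.2 (hle _ hmin))]
    linarith [min_le_left t₁ t₀]
  exact absurd hmin.2.2 (not_le.2 (hball hmem))

lemma IsExecution.triggerFun_nonpos (hX : IsExecution N T X) {i : Fin m} {k : ℕ} {s t : ℝ}
    (hs : X.τ i k = s) (hst : s ≤ t) (ht : (t : EReal) < X.τ i (k + 1)) (htT : (t : EReal) < T) :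
    triggerFun N X i s t ≤ 0 := by
  rcases hst.eq_or_lt with rfl | hlt
  · simp [triggerFun]
  · by_contra! hpos
    rw [hX.trigger_succ] at ht
    refine absurd ht (not_lt.2 (sInf_le ⟨t, ⟨?_, htT, ?_⟩, rfl⟩))
    · rw [hs]; exact_mod_cast hlt
    · rw [hs]; exact hpos.le

lemma IsExecution.triggerFun_succ_nonpos (hX : IsExecution N T X) (hT : 0 < T) {i : Fin m} {k : ℕ}
    {s s' : ℝ} (hs : X.τ i k = s) (hs' : X.τ i (k + 1) = s') (hss' : s < s') :
    triggerFun N X i s s' ≤ 0 := by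
  have hs'T := hX.trigger_lt hT hs'
  have hcl : closure (Set.Ico s s') = Set.Icc s s' := closure_Ico hss'.ne
  refine le_on_closure (s := Set.Ico s s') (f := triggerFun N X i s) (g := fun _ => 0) ?_ ?_
    continuousOn_const (hcl ▸ Set.right_mem_Icc.2 hss'.le)
  · intro t ht
    have := EReal.coe_lt_coe_iff.2 ht.2
    exact hX.triggerFun_nonpos hs ht.1 (hs' ▸ this) (this.trans hs'T)
  · rw [hcl]
    exact hX.triggerFun_continuousOn i (hX.nonneg_of_trigger hs) hss'.le hs'T

/-! ### Lower bounds for the inter-event times -/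

/-- Between two triggers the sampling error `e` satisfies `e' = A e + forcing`, so Gronwall's
inequality bounds it in terms of a bound of the forcing term. -/
lemma IsExecution.norm_error_le (hX : IsExecution N T X) (hA : N.A ≠ 0) {i : Fin m} {k : ℕ}
    {s h t : ℝ} (hs : X.τ i k = s)
    (hh : ∀ t : ℝ, s ≤ t → (t : EReal) < X.τ i (k + 1) → (t : EReal) < T →
      forcing N X i t ≤ h) (hst : s ≤ t) (ht : (t : EReal) ≤ X.τ i (k + 1))
    (htT : (t : EReal) < T) :
    ‖relState N X i s - relState N X i t‖ ≤
      h / specNorm N.A * (Real.exp (specNorm N.A * (t - s)) - 1) := by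
  have hs0 := hX.nonneg_of_trigger hs
  have key := norm_le_gronwallBound_of_norm_deriv_right_le
    (f := fun u => relState N X i s - relState N X i u) (f' := fun u => - relDeriv N X i u)
    (δ := 0) (K := specNorm N.A) (ε := h) (a := s) (b := t)
    (continuousOn_const.sub (hX.relState_continuousOn_Icc i hs0 htT))
    (fun u hu => (hX.relState_hasDeriv i (hs0.trans hu.1)
      ((EReal.coe_lt_coe_iff.2 hu.2).trans htT)).const_sub _) (by simp)
    (fun u hu => by
      have hut := EReal.coe_lt_coe_iff.2 hu.2
      have hheld : heldState N X i u = relState N X i s := by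
        rw [heldState, hX.lastTrigger_eq hs hu.1 (hut.trans_le ht)]
      have hb := hh u hu.1 (hut.trans_le ht) (hut.trans htT)
      rw [forcing_eq, hheld] at hb
      have heq : - relDeriv N X i u =
          Matrix.toEuclideanLin N.A (relState N X i s - relState N X i u) +
          (- Matrix.toEuclideanLin N.A (relState N X i s) +
            Matrix.toEuclideanLin (N.B * N.K) (∑ j, N.G.M i j • heldState N X j u)) := by
        rw [relDeriv, map_sub]; abel
      rw [heq]
      exact (norm_add_le _ _).trans (add_le_add (norm_toEuclideanLin_le _ _) hb))
    t ⟨hst, le_rfl⟩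
  rw [gronwallBound_of_K_ne_0 (specNorm_pos hA).ne'] at key
  simpa using key

lemma IsExecution.gap_le (hX : IsExecution N T X) (hT : 0 < T) (hβ : 0 < N.β) (hσ : 0 ≤ N.σ)
    (hA : N.A ≠ 0) {i : Fin m} (hκ : 0 ≤ N.κ i) {k : ℕ} {s s' h : ℝ} (hh0 : 0 < h)
    (hs : X.τ i k = s) (hs' : X.τ i (k + 1) = s')
    (hh : ∀ t : ℝ, s ≤ t → (t : EReal) < X.τ i (k + 1) → (t : EReal) < T →
      forcing N X i t ≤ h) : gap N h s' ≤ s' - s := by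
  have hlt : s < s' := by
    have := hX.trigger_lt_succ hT hβ hκ hs
    rw [hs'] at this
    exact_mod_cast this
  have hs'T := hX.trigger_lt hT hs'
  obtain ⟨v, hv, hev⟩ := hX.exists_error_ge i hκ (hX.nonneg_of_trigger hs) hlt hs'T
    (hX.triggerFun_succ_nonneg hs hs')
  have hvs' := EReal.coe_lt_coe_iff.2 hv.2
  have herr := hX.norm_error_le hA hs hh hv.1.le (hs' ▸ hvs'.le) (hvs'.trans hs'T)
  have ha := specNorm_pos hA
  set a := specNorm N.A with ha_def
  have hsqrt : Real.sqrt (N.β * Real.exp (-N.σ * s')) ≤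
      h / a * (Real.exp (a * (s' - s)) - 1) := by
    calc Real.sqrt (N.β * Real.exp (-N.σ * s'))
        ≤ ‖relState N X i s - relState N X i v‖ := by
          refine Real.sqrt_le_iff.2 ⟨norm_nonneg _, le_trans ?_ hev⟩
          have : -N.σ * s' ≤ -N.σ * v := by nlinarith [hv.2]
          gcongr
      _ ≤ h / a * (Real.exp (a * (v - s)) - 1) := herr
      _ ≤ _ := by
          have := hv.2.le
          gcongr
  have h1 : 1 + a / h * Real.sqrt (N.β * Real.exp (-N.σ * s')) ≤ Real.exp (a * (s' - s)) := by
    have := mul_le_mul_of_nonneg_left hsqrt (by positivity : 0 ≤ a / h)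
    have e : a / h * (h / a * (Real.exp (a * (s' - s)) - 1)) = Real.exp (a * (s' - s)) - 1 := by
      field_simp
    linarith
  have h2 := (Real.log_le_iff_le_exp (by positivity)).2 h1
  rw [gap, ← ha_def, one_div, inv_mul_le_iff₀ ha]
  exact h2

lemma gap_pos (hβ : 0 < N.β) (hA : N.A ≠ 0) {h : ℝ} (hh : 0 < h) (t : ℝ) : 0 < gap N h t := by
  have ha := specNorm_pos hA
  have : 0 < specNorm N.A / h * Real.sqrt (N.β * Real.exp (-N.σ * t)) := by positivity
  exact mul_pos (by positivity) (Real.log_pos (by linarith))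

lemma gap_antitone (hβ : 0 < N.β) (hσ : 0 ≤ N.σ) {h : ℝ} (hh : 0 < h) :
    Antitone (gap N h) := by
  intro t t' htt'
  have ha := specNorm_nonneg N.A
  have : -N.σ * t' ≤ -N.σ * t := by nlinarith
  unfold gap
  gcongr

lemma gap_continuous (hβ : 0 < N.β) {h : ℝ} (hh : 0 < h) : Continuous (gap N h) := by
  have ha := specNorm_nonneg N.A
  unfold gap
  refine continuous_const.mul (Continuous.log (by fun_prop) fun t => ?_)
  positivity

/-- The implicit equation for the guaranteed inter-event time has exactly one solution, because
its right-hand side is positive and nonincreasing in the unknown. -/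
lemma exists_gap_fixed (hβ : 0 < N.β) (hσ : 0 ≤ N.σ) (hA : N.A ≠ 0) {h : ℝ} (hh : 0 < h)
    (s : ℝ) : ∃ δ : ℝ, 0 < δ ∧ δ = gap N h (s + δ) ∧
      ∀ δ' : ℝ, δ' = gap N h (s + δ') → δ' = δ := by
  have hpos := gap_pos hβ hA hh
  have hanti := gap_antitone hβ hσ hh
  have hb : 0 ≤ gap N h s := (hpos s).le
  obtain ⟨δ, hδ, heq⟩ := intermediate_value_Icc hb
    (f := fun δ => δ - gap N h (s + δ))
    ((continuous_id.sub ((gap_continuous hβ hh).comp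
      (continuous_const.add continuous_id))).continuousOn)
    (show (0 : ℝ) ∈ Set.Icc _ _ from
      ⟨by have := hpos (s + 0); change 0 - gap N h (s + 0) ≤ 0; linarith, sub_nonneg.2 (hanti (by linarith))⟩)
  have heq : δ = gap N h (s + δ) := sub_eq_zero.1 heq
  refine ⟨δ, heq ▸ hpos _, heq, fun δ' h' => ?_⟩
  rcases le_total δ δ' with hle | hle
  · have := hanti (add_le_add_right hle s)
    linarith
  · have := hanti (add_le_add_right hle s)
    linarith

/-- The relative states are Lipschitz on bounded time intervals, and a trigger needs an error that
is bounded away from zero there. -/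
lemma IsExecution.not_zeno (hX : IsExecution N T X) (hT : 0 < T) (hβ : 0 < N.β) (hσ : 0 ≤ N.σ)
    {i : Fin m} (hκ : 0 ≤ N.κ i) : ¬ Zeno X i := by
  rintro ⟨S, hS⟩
  have hle : ∀ k, X.τ i k ≤ S := (hX.trigger_mono i).ge_of_tendsto hS
  have hr : ∀ k, X.τ i k = ((X.τ i k).toReal : EReal) := fun k =>
    (EReal.coe_toReal (ne_top_of_le_ne_top (EReal.coe_ne_top S) (hle k))
      (ne_bot_of_le_ne_bot EReal.zero_ne_bot (hX.trigger_nonneg i k))).symm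
  set u : ℕ → ℝ := fun k => (X.τ i k).toReal
  have hu : ∀ k, X.τ i k = (u k : EReal) := hr
  have huS : ∀ k, u k ≤ S := fun k => EReal.coe_le_coe_iff.1 (hu k ▸ hle k)
  have htend : Filter.Tendsto u Filter.atTop (nhds S) := by
    rw [← EReal.tendsto_coe]
    simpa only [← hu] using hS
  obtain ⟨y, hy, hb⟩ := hX.exists_relState_bound S
  set D := growthRate N * y + 1
  have hD : 0 < D := by have := growthRate_nonneg N; positivity
  set c := Real.sqrt (N.β * Real.exp (-N.σ * S)) / D
  have hc : 0 < c := by positivity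
  have hstep : ∀ k, c ≤ u (k + 1) - u k := by
    intro k
    have h0 := hX.nonneg_of_trigger (hu k)
    have hT' := hX.trigger_lt hT (hu (k + 1))
    have hlt : u k < u (k + 1) := by
      have := hX.trigger_lt_succ hT hβ hκ (hu k)
      rw [hu (k + 1)] at this
      exact_mod_cast this
    obtain ⟨v, hv, hev⟩ := hX.exists_error_ge i hκ h0 hlt hT'
      (hX.triggerFun_succ_nonneg (hu k) (hu (k + 1)))
    have hT'' : ∀ w ∈ Set.Ico (u k) (u (k + 1)), (w : EReal) < T := fun w hw =>
      (EReal.coe_lt_coe_iff.2 hw.2).trans hT'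
    have hlip := norm_image_sub_le_of_norm_deriv_right_le_segment (C := D)
      (hX.relState_continuousOn_Icc i h0 hT')
      (fun w hw => hX.relState_hasDeriv i (h0.trans hw.1) (hT'' w hw))
      (fun w hw => (hX.norm_relDeriv_le i (h0.trans hw.1) (hT'' w hw) fun j w' hw' =>
        hb j w' hw'.1 (hw'.2.trans (hw.2.le.trans (huS _)))
          ((EReal.coe_le_coe_iff.2 hw'.2).trans_lt (hT'' w hw))).trans (by linarith))
      v ⟨hv.1.le, hv.2.le⟩
    rw [norm_sub_rev] at hlip
    have hsq : Real.sqrt (N.β * Real.exp (-N.σ * S)) ≤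
        ‖relState N X i (u k) - relState N X i v‖ := by
      refine Real.sqrt_le_iff.2 ⟨norm_nonneg _, le_trans ?_ hev⟩
      have : -N.σ * S ≤ -N.σ * v := by nlinarith [hv.2, huS (k + 1)]
      gcongr
    rw [div_le_iff₀ hD]
    nlinarith [hv.2]
  have hlim := (htend.comp (Filter.tendsto_add_atTop_nat 1)).sub htend
  have := ge_of_tendsto' hlim hstep
  simp at this
  linarith

/-! ### Quadratic forms of the stabilizing design -/

lemma inner_toEuclideanLin_left {a b : ℕ} (A : Matrix (Fin a) (Fin b) ℝ)
    (x : EuclideanSpace ℝ (Fin b)) (y : EuclideanSpace ℝ (Fin a)) :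
    inner ℝ (Matrix.toEuclideanLin A x) y = inner ℝ x (Matrix.toEuclideanLin Aᵀ y) := by
  rw [← Matrix.conjTranspose_eq_transpose_of_trivial,
    Matrix.toEuclideanLin_conjTranspose_eq_adjoint, LinearMap.adjoint_inner_right]

lemma inner_toEuclideanLin_eq {d : ℕ} (S : Matrix (Fin d) (Fin d) ℝ)
    (x : EuclideanSpace ℝ (Fin d)) :
    inner ℝ x (Matrix.toEuclideanLin S x) = star x.ofLp ⬝ᵥ S *ᵥ x.ofLp := by
  rw [EuclideanSpace.inner_eq_star_dotProduct, dotProduct_comm]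
  simp [Matrix.toLpLin_apply]

lemma inner_toEuclideanLin_nonneg {d : ℕ} {S : Matrix (Fin d) (Fin d) ℝ} (hS : S.PosSemidef)
    (x : EuclideanSpace ℝ (Fin d)) : 0 ≤ inner ℝ x (Matrix.toEuclideanLin S x) := by
  rw [inner_toEuclideanLin_eq]
  exact hS.dotProduct_mulVec_nonneg _

/-- A positive definite matrix is bounded below by a positive multiple of the identity. -/
lemma exists_mul_norm_sq_le_inner {d : ℕ} {R : Matrix (Fin d) (Fin d) ℝ} (hR : R.PosDef) :
    ∃ c : ℝ, 0 < c ∧ ∀ x : EuclideanSpace ℝ (Fin d),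
      c * ‖x‖ ^ 2 ≤ inner ℝ x (Matrix.toEuclideanLin R x) := by
  set q : EuclideanSpace ℝ (Fin d) → ℝ := fun x => inner ℝ x (Matrix.toEuclideanLin R x) with hq
  have hqc : Continuous q :=
    continuous_id.inner (Matrix.toEuclideanLin R).continuous_of_finiteDimensional
  rcases (Metric.sphere (0 : EuclideanSpace ℝ (Fin d)) 1).eq_empty_or_nonempty with he | hne
  · refine ⟨1, one_pos, fun x => ?_⟩
    have hx : x = 0 := by
      by_contra hx
      have : ‖x‖⁻¹ • x ∈ Metric.sphere (0 : EuclideanSpace ℝ (Fin d)) 1 := by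
        simp [norm_smul, hx]
      rw [he] at this
      exact this
    simp [hx]
  · obtain ⟨x₀, hx₀, hmin⟩ := (isCompact_sphere _ _).exists_isMinOn hne hqc.continuousOn
    refine ⟨q x₀, ?_, fun x => ?_⟩
    · have : x₀ ≠ 0 := by
        rintro rfl
        simp at hx₀
      simp only [hq, inner_toEuclideanLin_eq]
      exact hR.dotProduct_mulVec_pos (by simpa using this)
    · by_cases hx : x = 0
      · simp [hx]
      · have hn : ‖x‖ ≠ 0 := norm_ne_zero_iff.2 hx
        have h := hmin (show ‖x‖⁻¹ • x ∈ Metric.sphere (0 : EuclideanSpace ℝ (Fin d)) 1 by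
          simp [norm_smul, hx])
        have h' : q x₀ ≤ ‖x‖⁻¹ * (‖x‖⁻¹ * inner ℝ x (Matrix.toEuclideanLin R x)) := by
          simpa [hq, inner_smul_left, inner_smul_right] using h
        calc q x₀ * ‖x‖ ^ 2
            ≤ ‖x‖⁻¹ * (‖x‖⁻¹ * inner ℝ x (Matrix.toEuclideanLin R x)) * ‖x‖ ^ 2 := by gcongr
          _ = _ := by field_simp

/-- The action of a matrix on stacked vectors has the spectral norm of the matrix as a bound. -/
lemma sum_norm_sq_mulVec_le {d e : ℕ} (M : Matrix (Fin d) (Fin d) ℝ)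
    (y : Fin d → EuclideanSpace ℝ (Fin e)) :
    ∑ i, ‖∑ j, M i j • y j‖ ^ 2 ≤ specNorm M ^ 2 * ∑ j, ‖y j‖ ^ 2 := by
  simp only [EuclideanSpace.norm_sq_eq]
  rw [Finset.sum_comm, Finset.sum_comm (s := Finset.univ (α := Fin d)), Finset.mul_sum]
  refine Finset.sum_le_sum fun c _ => ?_
  have h := norm_toEuclideanLin_le M (WithLp.toLp 2 fun j => y j c)
  have h2 := pow_le_pow_left₀ (norm_nonneg _) h 2
  rw [mul_pow, EuclideanSpace.norm_sq_eq, EuclideanSpace.norm_sq_eq] at h2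
  simpa [Matrix.toLpLin_apply, Matrix.mulVec, dotProduct] using h2

variable {R : Matrix (Fin n) (Fin n) ℝ} {ψ : Fin m → ℝ} {η ψ₀ v ρ κmax : ℝ}

lemma StabilizingDesign.transpose_R (hD : StabilizingDesign N R ψ η ψ₀ v ρ κmax) : Rᵀ = R := by
  rw [← Matrix.conjTranspose_eq_transpose_of_trivial]
  exact hD.R_pos.isHermitian

/-- The Riccati inequality as an inequality of quadratic forms. -/
lemma StabilizingDesign.inner_R_A_le (hD : StabilizingDesign N R ψ η ψ₀ v ρ κmax)
    (x : EuclideanSpace ℝ (Fin n)) :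
    2 * inner ℝ (Matrix.toEuclideanLin R x) (Matrix.toEuclideanLin N.A x) ≤
      η * ‖Matrix.toEuclideanLin N.K x‖ ^ 2 - η * ‖x‖ ^ 2 := by
  have h := inner_toEuclideanLin_nonneg hD.riccati.posSemidef x
  have e1 : inner ℝ x (Matrix.toEuclideanLin (N.Aᵀ * R) x) =
      inner ℝ (Matrix.toEuclideanLin R x) (Matrix.toEuclideanLin N.A x) := by
    rw [toEuclideanLin_mul_apply, ← inner_toEuclideanLin_left, real_inner_comm]
  have e2 : inner ℝ x (Matrix.toEuclideanLin (R * N.A) x) =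
      inner ℝ (Matrix.toEuclideanLin R x) (Matrix.toEuclideanLin N.A x) := by
    rw [toEuclideanLin_mul_apply, inner_toEuclideanLin_left, hD.transpose_R]
  have e3 : inner ℝ x (Matrix.toEuclideanLin (R * N.B * N.Bᵀ * R) x) =
      ‖Matrix.toEuclideanLin N.K x‖ ^ 2 := by
    rw [← real_inner_self_eq_norm_sq, inner_toEuclideanLin_left, ← toEuclideanLin_mul_apply,
      hD.gain, Matrix.transpose_mul, Matrix.transpose_transpose, hD.transpose_R]
    simp only [Matrix.mul_assoc]
  have e4 : inner ℝ x (Matrix.toEuclideanLin (1 : Matrix (Fin n) (Fin n) ℝ) x) = ‖x‖ ^ 2 := by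
    rw [← real_inner_self_eq_norm_sq, Matrix.toLpLin_one, LinearMap.id_apply]
  simp only [map_sub, map_neg, map_add, map_smul, LinearMap.sub_apply, LinearMap.neg_apply,
    LinearMap.add_apply, LinearMap.smul_apply, inner_sub_right, inner_neg_right,
    inner_add_right, inner_smul_right, e1, e2, e3, e4] at h
  linarith

/-- The inequality `Ψ M + Mᵀ Ψ > η Ψ` applied to stacked vectors. -/
lemma StabilizingDesign.sum_inner_M_ge (hD : StabilizingDesign N R ψ η ψ₀ v ρ κmax) {d : ℕ}
    (y : Fin m → EuclideanSpace ℝ (Fin d)) :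
    η * ∑ i, ψ i * ‖y i‖ ^ 2 ≤ 2 * ∑ i, ψ i * inner ℝ (y i) (∑ j, N.G.M i j • y j) := by
  have h : ∀ w : EuclideanSpace ℝ (Fin m),
      η * ∑ i, ψ i * w i ^ 2 ≤ 2 * ∑ i, ψ i * (w i * ∑ j, N.G.M i j * w j) := by
    intro w
    have h0 := inner_toEuclideanLin_nonneg hD.M_ineq.posSemidef w
    have e1 : inner ℝ w (Matrix.toEuclideanLin (Matrix.diagonal ψ * N.G.M) w) =
        ∑ i, ψ i * (w i * ∑ j, N.G.M i j * w j) := by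
      rw [toEuclideanLin_mul_apply]
      simp only [PiLp.inner_apply, Matrix.toLpLin_apply, Matrix.mulVec_diagonal]
      exact Finset.sum_congr rfl fun i _ => by simp [Matrix.mulVec, dotProduct]; ring
    have e2 : inner ℝ w (Matrix.toEuclideanLin (N.G.Mᵀ * Matrix.diagonal ψ) w) =
        inner ℝ w (Matrix.toEuclideanLin (Matrix.diagonal ψ * N.G.M) w) := by
      conv_rhs => rw [real_inner_comm, inner_toEuclideanLin_left, Matrix.transpose_mul,
        Matrix.diagonal_transpose]
    have e3 : inner ℝ w (Matrix.toEuclideanLin (Matrix.diagonal ψ) w) = ∑ i, ψ i * w i ^ 2 := by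
      simp [PiLp.inner_apply, Matrix.toLpLin_apply, Matrix.mulVec,
        dotProduct, Matrix.diagonal_apply]
      exact Finset.sum_congr rfl fun i _ => by ring
    simp only [map_sub, map_add, map_smul, LinearMap.sub_apply, LinearMap.add_apply,
      LinearMap.smul_apply, inner_sub_right, inner_add_right, inner_smul_right, e2, e3] at h0
    rw [e1] at h0
    linarith
  have hl : ∑ i, ψ i * ‖y i‖ ^ 2 = ∑ c, ∑ i, ψ i * y i c ^ 2 := by
    simp only [EuclideanSpace.norm_sq_eq, Finset.mul_sum, Real.norm_eq_abs, sq_abs]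
    exact Finset.sum_comm
  have hr : ∑ i, ψ i * inner ℝ (y i) (∑ j, N.G.M i j • y j) =
      ∑ c, ∑ i, ψ i * (y i c * ∑ j, N.G.M i j * y j c) := by
    rw [Finset.sum_comm]
    refine Finset.sum_congr rfl fun i _ => ?_
    rw [← Finset.mul_sum]
    simp [PiLp.inner_apply, mul_comm]
  rw [hl, hr, Finset.mul_sum, Finset.mul_sum]
  exact Finset.sum_le_sum fun c _ => h (WithLp.toLp 2 fun i => y i c)

/-- The bound `ρ` of `Ψ² ⊗ (R B K)²`, restricted to the block of agent `i`. -/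
lemma StabilizingDesign.norm_sq_RBK_le (hD : StabilizingDesign N R ψ η ψ₀ v ρ κmax) (i : Fin m)
    (g : EuclideanSpace ℝ (Fin n)) :
    ψ i ^ 2 * ‖Matrix.toEuclideanLin (R * N.B * N.K) g‖ ^ 2 ≤ ρ * ‖g‖ ^ 2 := by
  have hsub := hD.ρ_bound.submatrix (fun c : Fin n => (i, c))
  have heq : (ρ • (1 : Matrix (Fin m × Fin n) (Fin m × Fin n) ℝ) -
      ((Matrix.diagonal ψ) ^ 2) ⊗ₖ ((R * N.B * N.K) ^ 2)).submatrix
        (fun c : Fin n => (i, c)) (fun c : Fin n => (i, c)) =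
      ρ • (1 : Matrix (Fin n) (Fin n) ℝ) - ψ i ^ 2 • (R * N.B * N.K) ^ 2 := by
    ext c c'
    simp [Matrix.diagonal_pow, Matrix.one_apply]
  rw [heq] at hsub
  have h := inner_toEuclideanLin_nonneg hsub g
  have hsymm : (R * N.B * N.K)ᵀ = R * N.B * N.K := by
    simp only [hD.gain, Matrix.transpose_mul, Matrix.transpose_transpose, hD.transpose_R,
      Matrix.mul_assoc]
  have e1 : inner ℝ g (Matrix.toEuclideanLin ((R * N.B * N.K) ^ 2) g) =
      ‖Matrix.toEuclideanLin (R * N.B * N.K) g‖ ^ 2 := by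
    rw [← real_inner_self_eq_norm_sq, inner_toEuclideanLin_left, hsymm,
      ← toEuclideanLin_mul_apply, pow_two]
  simp only [map_sub, map_smul, LinearMap.sub_apply, LinearMap.smul_apply, inner_sub_right,
    inner_smul_right, Matrix.toLpLin_one, LinearMap.id_apply, real_inner_self_eq_norm_sq, e1] at h
  linarith

/-- The Lyapunov dissipation inequality in pointwise form: for relative states `x` and sampling
errors `e`, the derivative of `∑ ψ i * ⟪x i, R (x i)⟫` along the closed loop. -/
lemma StabilizingDesign.dissipation (hD : StabilizingDesign N R ψ η ψ₀ v ρ κmax)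
    (x e : Fin m → EuclideanSpace ℝ (Fin n)) :
    ∑ i, ψ i * (2 * inner ℝ (Matrix.toEuclideanLin R (x i)) (Matrix.toEuclideanLin N.A (x i) -
        Matrix.toEuclideanLin (N.B * N.K) (∑ j, N.G.M i j • (x j + e j)))) ≤
      - (η * ψ₀ - v) * ∑ i, ‖x i‖ ^ 2 +
        (Real.sqrt ρ * specNorm N.G.M) ^ 2 / v * ∑ i, ‖e i‖ ^ 2 := by
  have hv := hD.v_pos
  set g : Fin m → EuclideanSpace ℝ (Fin n) := fun i => ∑ j, N.G.M i j • e j with hg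
  have hRB : ∀ (a : EuclideanSpace ℝ (Fin n)) b,
      inner ℝ (Matrix.toEuclideanLin R a) (Matrix.toEuclideanLin (N.B * N.K) b) =
        inner ℝ (Matrix.toEuclideanLin N.K a) (Matrix.toEuclideanLin N.K b) := by
    intro a b
    rw [toEuclideanLin_mul_apply, real_inner_comm, inner_toEuclideanLin_left,
      ← toEuclideanLin_mul_apply, ← hD.gain, real_inner_comm]
  have hRBK : ∀ (a : EuclideanSpace ℝ (Fin n)) b,
      inner ℝ (Matrix.toEuclideanLin N.K a) (Matrix.toEuclideanLin N.K b) =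
        inner ℝ a (Matrix.toEuclideanLin (R * N.B * N.K) b) := by
    intro a b
    rw [← hRB, inner_toEuclideanLin_left, hD.transpose_R, ← toEuclideanLin_mul_apply,
      Matrix.mul_assoc]
  -- completing the square in the cross term
  have hcross : ∀ i, - (2 * (ψ i * inner ℝ (Matrix.toEuclideanLin N.K (x i))
      (Matrix.toEuclideanLin N.K (g i)))) ≤ v * ‖x i‖ ^ 2 + Real.sqrt ρ ^ 2 / v * ‖g i‖ ^ 2 := by
    intro i
    set z := Matrix.toEuclideanLin (R * N.B * N.K) (g i) with hz
    have hρ : ψ i ^ 2 * ‖z‖ ^ 2 ≤ Real.sqrt ρ ^ 2 * ‖g i‖ ^ 2 := by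
      refine (hD.norm_sq_RBK_le i (g i)).trans ?_
      have : ρ ≤ Real.sqrt ρ ^ 2 := by
        rw [Real.sq_sqrt']; exact le_max_left _ _
      gcongr
    have h0 : 0 ≤ ‖v • x i + ψ i • z‖ ^ 2 := sq_nonneg _
    rw [norm_add_sq_real, norm_smul, norm_smul, real_inner_smul_left, real_inner_smul_right,
      mul_pow, mul_pow, Real.norm_eq_abs, Real.norm_eq_abs, sq_abs, sq_abs] at h0
    rw [hRBK, ← hz]
    have h1 : v * (v * ‖x i‖ ^ 2 + Real.sqrt ρ ^ 2 / v * ‖g i‖ ^ 2) =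
        v ^ 2 * ‖x i‖ ^ 2 + Real.sqrt ρ ^ 2 * ‖g i‖ ^ 2 := by field_simp
    refine le_of_mul_le_mul_left ?_ hv
    rw [h1]
    linarith
  have hM := hD.sum_inner_M_ge fun i => Matrix.toEuclideanLin N.K (x i)
  have hexp : ∀ i, ψ i * (2 * inner ℝ (Matrix.toEuclideanLin R (x i))
      (Matrix.toEuclideanLin N.A (x i) -
        Matrix.toEuclideanLin (N.B * N.K) (∑ j, N.G.M i j • (x j + e j)))) =
      ψ i * (2 * inner ℝ (Matrix.toEuclideanLin R (x i)) (Matrix.toEuclideanLin N.A (x i))) -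
      2 * (ψ i * inner ℝ (Matrix.toEuclideanLin N.K (x i))
        (∑ j, N.G.M i j • Matrix.toEuclideanLin N.K (x j))) -
      2 * (ψ i * inner ℝ (Matrix.toEuclideanLin N.K (x i)) (Matrix.toEuclideanLin N.K (g i))) := by
    intro i
    have : ∑ j, N.G.M i j • (x j + e j) = ∑ j, N.G.M i j • x j + g i := by
      simp [hg, smul_add, Finset.sum_add_distrib]
    rw [this, inner_sub_right, hRB, map_add, inner_add_right, map_sum]
    simp only [map_smul]
    ring
  calc _ = ∑ i, ψ i * (2 * inner ℝ (Matrix.toEuclideanLin R (x i))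
          (Matrix.toEuclideanLin N.A (x i))) -
        2 * ∑ i, ψ i * inner ℝ (Matrix.toEuclideanLin N.K (x i))
          (∑ j, N.G.M i j • Matrix.toEuclideanLin N.K (x j)) +
        ∑ i, - (2 * (ψ i * inner ℝ (Matrix.toEuclideanLin N.K (x i))
          (Matrix.toEuclideanLin N.K (g i)))) := by
        rw [Finset.sum_congr rfl fun i _ => hexp i]
        simp only [Finset.sum_sub_distrib, Finset.sum_neg_distrib, Finset.mul_sum]
        ring
    _ ≤ ∑ i, (η * (ψ i * ‖Matrix.toEuclideanLin N.K (x i)‖ ^ 2) - η * ψ₀ * ‖x i‖ ^ 2) -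
        η * ∑ i, ψ i * ‖Matrix.toEuclideanLin N.K (x i)‖ ^ 2 +
        ∑ i, (v * ‖x i‖ ^ 2 + Real.sqrt ρ ^ 2 / v * ‖g i‖ ^ 2) := by
        refine add_le_add (sub_le_sub (Finset.sum_le_sum fun i _ => ?_) hM)
          (Finset.sum_le_sum fun i _ => hcross i)
        have h1 := mul_le_mul_of_nonneg_left (hD.inner_R_A_le (x i)) (hD.ψ_pos i).le
        have h2 : η * ψ₀ * ‖x i‖ ^ 2 ≤ η * ψ i * ‖x i‖ ^ 2 := by
          have := hD.ψ₀_le i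
          have := hD.η_pos
          gcongr
        linarith
    _ = - (η * ψ₀ - v) * ∑ i, ‖x i‖ ^ 2 + Real.sqrt ρ ^ 2 / v * ∑ i, ‖g i‖ ^ 2 := by
        simp only [Finset.sum_sub_distrib, Finset.sum_add_distrib, ← Finset.mul_sum]
        ring
    _ ≤ _ := by
        have := mul_le_mul_of_nonneg_left (sum_norm_sq_mulVec_le N.G.M e)
          (by positivity : 0 ≤ Real.sqrt ρ ^ 2 / v)
        rw [mul_pow]
        calc _ ≤ _ := add_le_add_right this _
          _ = _ := by ring

/-- The smallness of the trigger gains makes the dissipation inequality an inequality against the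
quantity `‖e‖² - κ ‖x + e‖²` whose integral the trigger rule controls. -/
lemma StabilizingDesign.exists_supply_rate (hD : StabilizingDesign N R ψ η ψ₀ v ρ κmax) :
    ∃ c : ℝ, 0 ≤ c ∧ ∀ (i : Fin m) (x e : EuclideanSpace ℝ (Fin n)),
      - (η * ψ₀ - v) * ‖x‖ ^ 2 + (Real.sqrt ρ * specNorm N.G.M) ^ 2 / v * ‖e‖ ^ 2 ≤
        c * (‖e‖ ^ 2 - N.κ i * ‖x + e‖ ^ 2) := by
  have hv := hD.v_pos
  have hς := hD.ς_pos
  set ς := η * ψ₀ - v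
  set z := Real.sqrt ρ * specNorm N.G.M with hz
  have hz0 : 0 ≤ z := mul_nonneg (Real.sqrt_nonneg _) (specNorm_nonneg _)
  set q := Real.sqrt κmax with hq
  have hq0 : 0 ≤ q := Real.sqrt_nonneg _
  set w := Real.sqrt (ς * v) with hw
  have hw0 : 0 < w := by positivity
  have hw2 : w ^ 2 = ς * v := Real.sq_sqrt (by positivity)
  have hqw : q * (z + w) < w := (lt_div_iff₀ (by positivity)).1 hD.κmax_lt
  have hq1 : q < 1 := by
    by_contra! h
    nlinarith
  have hqz : q * z ≤ w * (1 - q) := by nlinarith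
  have hqz2 : q ^ 2 * z ^ 2 ≤ ς * v * (1 - q) ^ 2 := by
    have := pow_le_pow_left₀ (by positivity) hqz 2
    rwa [mul_pow q, mul_pow w, hw2] at this
  have h1q : 0 < 1 - q := sub_pos.2 hq1
  refine ⟨z ^ 2 / (v * (1 - q)), by positivity, fun i x e => ?_⟩
  have hκ : N.κ i ≤ q ^ 2 := (hD.κ_le i).trans (by
    rw [hq, Real.sq_sqrt']; exact le_max_left _ _)
  have hsq : (1 - q) * (q ^ 2 * ‖x + e‖ ^ 2) ≤ (1 - q) * (q * ‖e‖ ^ 2) + q ^ 2 * ‖x‖ ^ 2 := by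
    have h1 : ‖x + e‖ ^ 2 ≤ (‖x‖ + ‖e‖) ^ 2 := by gcongr; exact norm_add_le _ _
    have h2 : (1 - q) * (q ^ 2 * ‖x + e‖ ^ 2) ≤ (1 - q) * (q ^ 2 * (‖x‖ + ‖e‖) ^ 2) := by
      gcongr
    have h3 := mul_nonneg hq0 (sq_nonneg ((1 - q) * ‖e‖ - q * ‖x‖))
    nlinarith
  have hκe : (1 - q) * (N.κ i * ‖x + e‖ ^ 2) ≤ (1 - q) * (q ^ 2 * ‖x + e‖ ^ 2) := by gcongr
  have hz2 : z ^ 2 * (q ^ 2 * ‖x‖ ^ 2) ≤ ς * v * (1 - q) ^ 2 * ‖x‖ ^ 2 := by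
    have := mul_le_mul_of_nonneg_right hqz2 (sq_nonneg ‖x‖)
    linarith
  have hkey : z ^ 2 * ((1 - q) * (N.κ i * ‖x + e‖ ^ 2)) ≤
      z ^ 2 * ((1 - q) * (q * ‖e‖ ^ 2) + q ^ 2 * ‖x‖ ^ 2) :=
    mul_le_mul_of_nonneg_left (hκe.trans hsq) (sq_nonneg z)
  -- multiply the claim by `v * (1 - q) ^ 2`
  refine le_of_mul_le_mul_left ?_ (by positivity : 0 < v * (1 - q) ^ 2)
  have el : v * (1 - q) ^ 2 * (-ς * ‖x‖ ^ 2 + z ^ 2 / v * ‖e‖ ^ 2) =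
      - (ς * v * (1 - q) ^ 2 * ‖x‖ ^ 2) + (1 - q) ^ 2 * z ^ 2 * ‖e‖ ^ 2 := by
    field_simp
  have er : v * (1 - q) ^ 2 * (z ^ 2 / (v * (1 - q)) * (‖e‖ ^ 2 - N.κ i * ‖x + e‖ ^ 2)) =
      (1 - q) * z ^ 2 * ‖e‖ ^ 2 - z ^ 2 * ((1 - q) * (N.κ i * ‖x + e‖ ^ 2)) := by
    field_simp
  rw [el, er]
  linarith

/-! ### The trigger rule in integrated form -/

/-- The rate `‖e_i‖² - κ i ‖P̂_i‖² - β e^{-σ v}` along the whole trajectory, with the sampled value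
updated at each trigger instant. -/
noncomputable def heldRate (N : Network m r n p) (X : Trajectory m r n) (i : Fin m) (v : ℝ) : ℝ :=
  triggerRate N X i (lastTrigger X i v) v

/-- Adding up the trigger functions of consecutive inter-event intervals. -/
lemma IsExecution.integral_heldRate_step (hX : IsExecution N T X) {i : Fin m} {k : ℕ} {s t : ℝ}
    (hs : X.τ i k = s) (hst : s ≤ t) (ht : (t : EReal) ≤ X.τ i (k + 1)) (htT : (t : EReal) < T)
    (hf : triggerFun N X i s t ≤ 0)
    (hint : IntervalIntegrable (heldRate N X i) MeasureTheory.volume 0 s)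
    (hle : ∫ v in (0 : ℝ)..s, heldRate N X i v ≤ 0) :
    IntervalIntegrable (heldRate N X i) MeasureTheory.volume 0 t ∧
      ∫ v in (0 : ℝ)..t, heldRate N X i v ≤ 0 := by
  have hs0 := hX.nonneg_of_trigger hs
  have heq : Set.EqOn (triggerRate N X i s) (heldRate N X i) (Set.Ioo s t) := fun v hv => by
    rw [heldRate, hX.lastTrigger_eq hs hv.1.le ((EReal.coe_lt_coe_iff.2 hv.2).trans_le ht)]
  have hint' : IntervalIntegrable (heldRate N X i) MeasureTheory.volume s t :=
    ((hX.triggerRate_continuousOn i hs0 htT).intervalIntegrable_of_Icc hst).congr_uIoo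
      (by rwa [Set.uIoo_of_le hst])
  refine ⟨hint.trans hint', ?_⟩
  rw [← intervalIntegral.integral_add_adjacent_intervals hint hint',
    ← intervalIntegral.integral_congr_Ioo_of_le hst heq, ← hX.triggerFun_eq i hs0 hst htT]
  linarith

lemma IsExecution.integral_heldRate_nonpos (hX : IsExecution N T X) (hT : 0 < T) (i : Fin m)
    {t : ℝ} (h0 : 0 ≤ t) (htT : (t : EReal) < T) :
    IntervalIntegrable (heldRate N X i) MeasureTheory.volume 0 t ∧
      ∫ v in (0 : ℝ)..t, heldRate N X i v ≤ 0 := by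
  have htrig : ∀ k, ∀ s : ℝ, X.τ i k = s →
      IntervalIntegrable (heldRate N X i) MeasureTheory.volume 0 s ∧
        ∫ v in (0 : ℝ)..s, heldRate N X i v ≤ 0 := by
    intro k
    induction k with
    | zero =>
      intro s hs
      have : s = 0 := by
        rw [hX.trigger_zero] at hs
        exact_mod_cast hs.symm
      subst this
      simp
    | succ k ih =>
      intro s' hs'
      have hle := hX.trigger_le_succ i k
      have hr : X.τ i k = ((X.τ i k).toReal : EReal) :=
        (EReal.coe_toReal (ne_top_of_le_ne_top (EReal.coe_ne_top s') (hs' ▸ hle))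
          (ne_bot_of_le_ne_bot EReal.zero_ne_bot (hX.trigger_nonneg i k))).symm
      have hss' : (X.τ i k).toReal ≤ s' := by
        rw [hr, hs'] at hle
        exact_mod_cast hle
      rcases hss'.eq_or_lt with h | h
      · exact ih s' (h ▸ hr)
      · obtain ⟨h1, h2⟩ := ih _ hr
        exact hX.integral_heldRate_step hr hss' hs'.ge (hX.trigger_lt hT hs')
          (hX.triggerFun_succ_nonpos hT hr hs' h) h1 h2
  obtain ⟨k, s, hs, -, hst, hk⟩ := hX.exists_trigger i h0 htT
  obtain ⟨h1, h2⟩ := htrig k s hs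
  exact hX.integral_heldRate_step hs hst hk.le htT (hX.triggerFun_nonpos hs hst hk htT) h1 h2

lemma integral_exp_decay_le {β σ t : ℝ} (hβ : 0 ≤ β) (hσ : 0 < σ) :
    ∫ v in (0 : ℝ)..t, β * Real.exp (-σ * v) ≤ β / σ := by
  have h : ∀ v ∈ Set.uIcc 0 t, HasDerivAt (fun v => - (β / σ) * Real.exp (-σ * v))
      (β * Real.exp (-σ * v)) v := fun v _ => by
    refine ((((hasDerivAt_id v).const_mul (-σ)).exp).const_mul (-(β / σ))).congr_deriv ?_
    simp only [id]
    field_simp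
  rw [intervalIntegral.integral_eq_sub_of_hasDerivAt h
    (Continuous.intervalIntegrable (by fun_prop) _ _)]
  have : 0 ≤ β / σ * Real.exp (-σ * t) := by positivity
  rw [mul_zero, Real.exp_zero]
  linarith

/-! ### Boundedness under a stabilizing design -/

/-- The Lyapunov function `∑ ψ i * ⟪P_i, R P_i⟫` of the relative states. -/
noncomputable def lyapunov (N : Network m r n p) (X : Trajectory m r n)
    (R : Matrix (Fin n) (Fin n) ℝ) (ψ : Fin m → ℝ) (t : ℝ) : ℝ :=
  ∑ i, ψ i * inner ℝ (relState N X i t) (Matrix.toEuclideanLin R (relState N X i t))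

/-- The Lyapunov function stays bounded: its growth is at most a multiple of the integral of
`∑ (‖e_i‖² - κ i ‖P̂_i‖²)`, and the trigger rule bounds that integral by `m β / σ`. -/
lemma IsExecution.lyapunov_bounded (hX : IsExecution N T X) (hT : 0 < T) (hβ : 0 < N.β)
    (hσ : 0 < N.σ) (hD : StabilizingDesign N R ψ η ψ₀ v ρ κmax) :
    ∃ C : ℝ, ∀ t : ℝ, 0 ≤ t → (t : EReal) < T → lyapunov N X R ψ t ≤ C := by
  obtain ⟨c, hc, hsupply⟩ := hD.exists_supply_rate
  refine ⟨lyapunov N X R ψ 0 + c * ∑ _i : Fin m, N.β / N.σ, fun t h0 htT => ?_⟩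
  have hcont : ContinuousOn (lyapunov N X R ψ) (Set.Icc 0 t) := by
    refine continuousOn_finsetSum _ fun i _ => continuousOn_const.mul ?_
    have h := hX.relState_continuousOn_Icc i le_rfl htT
    exact h.inner ((Matrix.toEuclideanLin R).continuous_of_finiteDimensional.comp_continuousOn h)
  have hderiv : ∀ u ∈ Set.Ioo 0 t, HasDerivWithinAt (lyapunov N X R ψ)
      (∑ i, ψ i * (2 * inner ℝ (Matrix.toEuclideanLin R (relState N X i u))
        (relDeriv N X i u))) (Set.Ioi u) u := by
    intro u hu
    refine HasDerivWithinAt.fun_sum fun i _ => HasDerivWithinAt.const_mul _ ?_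
    have h := (hX.relState_hasDeriv i hu.1.le
      ((EReal.coe_lt_coe_iff.2 hu.2).trans htT)).mono Set.Ioi_subset_Ici_self
    have h' := (LinearMap.toContinuousLinearMap
      (Matrix.toEuclideanLin R)).hasFDerivAt.comp_hasDerivWithinAt u h
    refine (h.inner ℝ h').congr_deriv ?_
    simp only [LinearMap.coe_toContinuousLinearMap', Function.comp_apply]
    rw [real_inner_comm, inner_toEuclideanLin_left, hD.transpose_R,
      real_inner_comm _ (relDeriv N X i u), inner_toEuclideanLin_left R, hD.transpose_R]
    ring
  have hint := fun i => (hX.integral_heldRate_nonpos hT i h0 htT).1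
  have hintexp : IntervalIntegrable (fun u => N.β * Real.exp (-N.σ * u))
      MeasureTheory.volume 0 t := Continuous.intervalIntegrable (by fun_prop) _ _
  have hintsum : IntervalIntegrable
      (fun u => c * ∑ i, (heldRate N X i u + N.β * Real.exp (-N.σ * u)))
      MeasureTheory.volume 0 t := by
    refine IntervalIntegrable.const_mul ?_ c
    have := IntervalIntegrable.sum Finset.univ fun i _ => (hint i).add hintexp
    refine this.congr fun u _ => ?_
    simp
  have key := intervalIntegral.sub_le_integral_of_hasDeriv_right_of_le h0 hcont hderiv
    ((intervalIntegrable_iff_integrableOn_Icc_of_le h0).1 hintsum) (fun u hu => by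
      have hd := hD.dissipation (fun i => relState N X i u)
        (fun i => heldState N X i u - relState N X i u)
      simp only [add_sub_cancel] at hd
      refine hd.trans ?_
      rw [Finset.mul_sum, Finset.mul_sum, Finset.mul_sum, ← Finset.sum_add_distrib]
      refine Finset.sum_le_sum fun i _ => ?_
      have hi := hsupply i (relState N X i u) (heldState N X i u - relState N X i u)
      rw [add_sub_cancel] at hi
      refine hi.trans_eq ?_
      rw [heldRate, triggerRate, heldState]
      ring)
  have hval : ∫ u in (0 : ℝ)..t, c * ∑ i, (heldRate N X i u + N.β * Real.exp (-N.σ * u)) ≤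
      c * ∑ _i : Fin m, N.β / N.σ := by
    rw [intervalIntegral.integral_const_mul,
      intervalIntegral.integral_finsetSum fun i _ => (hint i).add hintexp]
    refine mul_le_mul_of_nonneg_left (Finset.sum_le_sum fun i _ => ?_) hc
    rw [intervalIntegral.integral_add (hint i) hintexp]
    have h1 := (hX.integral_heldRate_nonpos hT i h0 htT).2
    have h2 := integral_exp_decay_le (t := t) hβ.le hσ
    linarith
  linarith

lemma IsExecution.exists_uniform_forcing_bound (hX : IsExecution N T X) (hT : 0 < T)
    (hβ : 0 < N.β) (hσ : 0 < N.σ) (hD : StabilizingDesign N R ψ η ψ₀ v ρ κmax) (i : Fin m) :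
    ∃ h : ℝ, 0 < h ∧ ∀ t : ℝ, 0 ≤ t → (t : EReal) < T → forcing N X i t ≤ h := by
  obtain ⟨C, hC⟩ := hX.lyapunov_bounded hT hβ hσ hD
  obtain ⟨c, hc, hR⟩ := exists_mul_norm_sq_le_inner hD.R_pos
  have hterm : ∀ j t, ψ j * (c * ‖relState N X j t‖ ^ 2) ≤
      ψ j * inner ℝ (relState N X j t) (Matrix.toEuclideanLin R (relState N X j t)) :=
    fun j t => mul_le_mul_of_nonneg_left (hR _) (hD.ψ_pos j).le
  have hP : ∀ j, ∀ t : ℝ, 0 ≤ t → (t : EReal) < T →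
      ‖relState N X j t‖ ≤ ∑ l, Real.sqrt (C / (ψ l * c)) := by
    intro j t h0 htT
    have hψ := hD.ψ_pos j
    have h1 : ψ j * (c * ‖relState N X j t‖ ^ 2) ≤ C := by
      refine (hterm j t).trans (le_trans ?_ (hC t h0 htT))
      refine Finset.single_le_sum (f := fun j => ψ j * inner ℝ (relState N X j t)
        (Matrix.toEuclideanLin R (relState N X j t))) (fun l _ => ?_) (Finset.mem_univ j)
      have := hD.ψ_pos l
      exact le_trans (by positivity) (hterm l t)
    have h2 : ‖relState N X j t‖ ≤ Real.sqrt (C / (ψ j * c)) := by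
      refine Real.le_sqrt_of_sq_le ?_
      rw [le_div_iff₀ (by positivity)]
      linarith
    exact h2.trans (Finset.single_le_sum (f := fun l => Real.sqrt (C / (ψ l * c)))
      (fun _ _ => Real.sqrt_nonneg _) (Finset.mem_univ j))
  have hg := growthRate_nonneg N
  set y := ∑ l, Real.sqrt (C / (ψ l * c))
  have hy : 0 ≤ y := Finset.sum_nonneg fun _ _ => Real.sqrt_nonneg _
  refine ⟨growthRate N * y + 1, by positivity, fun t h0 htT => ?_⟩
  have := hX.forcing_le i h0 htT fun j u hu =>
    hP j u hu.1 ((EReal.coe_le_coe_iff.2 hu.2).trans_lt htT)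
  linarith

end EventTriggered

theorem theorem2 {m r n p : ℕ} (N : EventTriggered.Network m r n p)
    (hκ : ∀ i, 0 ≤ N.κ i) (hβ : 0 < N.β) (hσ : 0 < N.σ)
    (T : EReal) (hT : 0 < T) (X : EventTriggered.Trajectory m r n)
    (hX : EventTriggered.IsExecution N T X) :
    -- no Zeno behaviour
    (∀ i, ¬ EventTriggered.Zeno X i) ∧
    -- on every bounded time horizon the forcing terms are bounded by a positive constant
    (∀ i (S : ℝ), ∃ h : ℝ, 0 < h ∧ ∀ t : ℝ, 0 ≤ t → t < S → (t : EReal) < T →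
      EventTriggered.forcing N X i t ≤ h) ∧
    -- under a stabilizing design they are bounded by a positive constant for all times
    (∀ (R : Matrix (Fin n) (Fin n) ℝ) (ψ : Fin m → ℝ) (η ψ₀ v ρ κmax : ℝ),
      EventTriggered.StabilizingDesign N R ψ η ψ₀ v ρ κmax →
      ∀ i, ∃ h : ℝ, 0 < h ∧ ∀ t : ℝ, 0 ≤ t → (t : EReal) < T →
        EventTriggered.forcing N X i t ≤ h) ∧
    -- lower bound for the inter-event intervals: `s` is the `k`-th trigger instant of agent `i`,
    -- and `h` bounds its forcing term up to the next one
    (N.A ≠ 0 → ∀ i k (s : ℝ), X.τ i k = (s : EReal) →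
      ∀ h : ℝ, 0 < h →
      (∀ t : ℝ, s ≤ t → (t : EReal) < X.τ i (k + 1) → (t : EReal) < T →
        EventTriggered.forcing N X i t ≤ h) →
      (∃ δ : ℝ, 0 < δ ∧ δ = EventTriggered.gap N h (s + δ) ∧
        (∀ δ' : ℝ, δ' = EventTriggered.gap N h (s + δ') → δ' = δ) ∧
        ((s + δ : ℝ) : EReal) ≤ X.τ i (k + 1)) ∧
      (∀ s' : ℝ, X.τ i (k + 1) = (s' : EReal) →
        EventTriggered.gap N h s' ≤ s' - s)) := by
  refine ⟨fun i => hX.not_zeno hT hβ hσ.le (hκ i), fun i S => ?_, fun R ψ η ψ₀ v ρ κmax hD i =>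
    hX.exists_uniform_forcing_bound hT hβ hσ hD i, fun hA i k s hs h hh hb => ⟨?_, fun s' hs' =>
    hX.gap_le hT hβ hσ.le hA (hκ i) hh hs hs' hb⟩⟩
  · obtain ⟨h, hh, hb⟩ := hX.exists_forcing_bound S
    exact ⟨h, hh, fun t h0 htS htT => hb i t h0 htS.le htT⟩
  · obtain ⟨δ, hδ, heq, huniq⟩ := EventTriggered.exists_gap_fixed hβ hσ.le hA hh s
    refine ⟨δ, hδ, heq, huniq, ?_⟩
    by_contra! hlt
    have hr : X.τ i (k + 1) = ((X.τ i (k + 1)).toReal : EReal) :=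
      (EReal.coe_toReal (ne_top_of_lt hlt)
        (ne_bot_of_le_ne_bot EReal.zero_ne_bot (hX.trigger_nonneg i _))).symm
    set s' := (X.τ i (k + 1)).toReal
    rw [hr] at hlt
    have hlt' : s' < s + δ := by exact_mod_cast hlt
    -- an earlier trigger would have a longer guaranteed gap, as `gap` is nonincreasing in time
    have h1 := hX.gap_le hT hβ hσ.le hA (hκ i) hh hs hr hb
    have h2 := EventTriggered.gap_antitone hβ hσ.le hh hlt'.le
    linarith
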